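/- Let $P$ be a probability distribution on a measurable space $\mathcal X$, and let $y:\mathcal X\to\{-1,1\}$ be a measurable labelling. Write $\mathrm{sgn}(t)=1$ for $t\ge 0$ and $\mathrm{sgn}(t)=-1$ for $t<0$, let $\mathcal L(y',y)=\mathbf 1\{\mathrm{sgn}(y')\ne y\}$ be the zero-one loss, and let $R_P(f)=\mathbb E_{\mathbf x\sim P}[\mathcal L(f(\mathbf x),y(\mathbf x))]$ be the risk of $f:\mathcal X\to\mathbb R$. Let $\mathcal F$ be a class of measurable functions $f:\mathcal X\to\mathbb R$ of finite VC dimension $h$, that is, $h$ is the largest cardinality of a finite subset of $\mathcal X$ all of whose dichotomies are induced by functions $\mathrm{sgn}(f)$, $f\in\mathcal F$. Assume that $\mathcal F$ is measurable in the following sense: for all $m$ and all $b\in\{-1,1\}^m$, the set of $(z_1,\dots,z_m)\in\mathcal X^m$ for which some $f\in\mathcal F$ satisfies $\mathrm{sgn}(f(z_i))=b_i$ for all $i$ is $P^m$-measurable (measurable up to a $P^m$-null set). Let $n\ge 1$ with $h\le 2n$, let $0<\eta\le 1$, let $\mathbf x_1,\dots,\mathbf x_n$ be sampled i.i.d. from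 $P$, and put $y_i=y(\mathbf x_i)$. Then with probability at least $1-\eta$ the following holds simultaneously for all $f\in\mathcal F$ and all soft labels $\ell^*=(\ell^*_1,\dots,\ell^*_n)\in\mathbb R^n$ (so that both may be chosen depending on the sample, for instance $\ell^*$ as the labels induced by a data adjacency graph): $$R_P(f)\ \le\ \frac1n\sum_{i=1}^n\mathcal L\bigl(f(\mathbf x_i),\mathrm{sgn}(\ell_i^*)\bigr)+\frac1n\sum_{i=1}^n(\ell_i^*-y_i)^2+\sqrt{\frac{h\,(\ln(2n/h)+1)-\ln(\eta/4)}{n}},$$ where $h\,(\ln(2n/h)+1)$ is read as $0$ for $h=0$. -/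

import Mathlib

open MeasureTheory ProbabilityTheory

noncomputable section

namespace MaxMarginCuts

/-- The two-valued sign of a real number, used as a predicted label in `{-1, 1}`.
A prediction has to be one of the two labels, so `0` is given the label `1`. -/
def sgn (t : ℝ) : ℝ := if 0 ≤ t then 1 else -1

/-- The zero-one loss of the prediction `sgn y'` given the ground truth `y`. -/
def zeroOneLoss (y' y : ℝ) : ℝ := if sgn y' ≠ y then 1 else 0

/-- The risk of `f`: the expected zero-one loss under the distribution `P` of the examples, with
the labels given by the deterministic function `y`. -/
def risk {𝒳 : Type*} [MeasurableSpace 𝒳] (P : Measure 𝒳) (y f : 𝒳 → ℝ) : ℝ :=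
  ∫ x, zeroOneLoss (f x) (y x) ∂P

/-- A class `F` of real-valued discriminators shatters a finite set `S` of points if every
dichotomy of `S` is induced by the sign of a member of `F`. -/
def Shatters {𝒳 : Type*} (F : Set (𝒳 → ℝ)) (S : Finset 𝒳) : Prop :=
  ∀ T ⊆ S, ∃ f ∈ F, ∀ x ∈ S, sgn (f x) = 1 ↔ x ∈ T

/-- The VC dimension of a class of discriminators: the supremum of the cardinalities of the finite
sets that it shatters (`⊤` if these are unbounded). -/
def vcDim {𝒳 : Type*} (F : Set (𝒳 → ℝ)) : ℕ∞ :=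
  ⨆ (S : Finset 𝒳) (_ : Shatters F S), (S.card : ℕ∞)

/-- Measurability of a (possibly uncountable) class of discriminators with respect to `P`: its
members are measurable, and for every sequence `b` of `m` labels, the set of the `m`-tuples of
points that some member of the class labels by `b` is measurable up to a null set of `P ^ m`. -/
structure IsMeasurableClass {𝒳 : Type*} [MeasurableSpace 𝒳] (P : Measure 𝒳)
    (F : Set (𝒳 → ℝ)) : Prop where
  measurable : ∀ f ∈ F, Measurable f
  nullMeasurableSet : ∀ (m : ℕ) (b : Fin m → ℝ),
    NullMeasurableSet {z : Fin m → 𝒳 | ∃ f ∈ F, ∀ i, sgn (f (z i)) = b i}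
      (Measure.pi fun _ => P)

/-- The inductive error `Δ_I(h, n, η)`. For `h = 0` the term `h (ln (2 n / h) + 1)` is `0`. -/
def inductiveError (h n : ℕ) (η : ℝ) : ℝ :=
  Real.sqrt (((h : ℝ) * (Real.log (2 * (n : ℝ) / (h : ℝ)) + 1) - Real.log (η / 4)) / (n : ℝ))

end MaxMarginCuts

end

/-! Soft labels enter only through a pointwise inequality, `zeroOneLoss_le_add`: where the loss
against `sgn l` misses an error against the true label `b`, the sign of `l` disagrees with `b`, so
`(l - b) ^ 2 ≥ 1`. What remains is a uniform one-sided VC bound with true labels.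

That bound uses a ghost sample at the level of exponential moments. By Jensen, `exp (t * (n * risk -
errors))` is at most its average with `n * risk` replaced by the errors on an independent second
sample (`exp_le_lintegral_exp_sum`). On the joint sample of `2n` points, the supremum over the class
is dominated by a sum over the induced sign patterns. The joint law is invariant under permutations,
so the points may be frozen and randomly permuted: Sauer–Shelah bounds the number of patterns, and a
Hoeffding bound for sampling without replacement controls each one (`sum_perm_exp_sub_le`). Markov's
inequality finishes; the `4` in `η / 4` absorbs the gap between the variance obtained and the ideal
one. -/

namespace MaxMarginCuts

/-! ### Exponential moments for sampling without replacement. -/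

/-- Hoeffding's lemma for the uniform distribution on `Fin (N + 1)`. -/
lemma sum_exp_le_of_mem_Icc {N : ℕ} (v : Fin (N + 1) → ℝ) (hv : ∀ i, v i ∈ Set.Icc (0 : ℝ) 1)
    (s : ℝ) :
    ∑ p, Real.exp (s * v p) ≤
      ((N : ℝ) + 1) * Real.exp (s * ((∑ p, v p) / ((N : ℝ) + 1)) + s ^ 2 / 8) := by
  have hN : (0 : ℝ) < (N : ℝ) + 1 := by positivity
  have hint : ∀ g : Fin (N + 1) → ℝ,
      ∫ p, g p ∂(PMF.uniformOfFintype (Fin (N + 1))).toMeasure = (∑ p, g p) / ((N : ℝ) + 1) := by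
    intro g
    rw [PMF.integral_eq_sum, Finset.sum_div]
    refine Finset.sum_congr rfl fun p _ => ?_
    simp only [PMF.uniformOfFintype_apply, Fintype.card_fin, ENNReal.toReal_inv,
      ENNReal.toReal_natCast, smul_eq_mul]
    rw [div_eq_inv_mul]
    push_cast
    rfl
  have key := (hasSubgaussianMGF_of_mem_Icc (μ := (PMF.uniformOfFintype (Fin (N + 1))).toMeasure)
    (X := v) (measurable_of_finite v).aemeasurable (ae_of_all _ hv)).mgf_le s
  rw [mgf, hint, hint, div_le_iff₀ hN] at key
  have h1 : ∑ p, Real.exp (s * v p) = Real.exp (s * ((∑ p, v p) / ((N : ℝ) + 1))) *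
      ∑ p, Real.exp (s * (v p - (∑ p, v p) / ((N : ℝ) + 1))) := by
    rw [Finset.mul_sum]
    refine Finset.sum_congr rfl fun p _ => ?_
    rw [← Real.exp_add]
    ring_nf
  rw [h1, Real.exp_add]
  have h2 : Real.exp (((((‖(1 : ℝ) - 0‖₊ / 2) ^ 2 : NNReal)) : ℝ) * s ^ 2 / 2)
      = Real.exp (s ^ 2 / 8) := by
    congr 1
    push_cast
    norm_num
    ring
  rw [h2] at key
  calc _ ≤ Real.exp (s * ((∑ p, v p) / ((N : ℝ) + 1))) *
        (Real.exp (s ^ 2 / 8) * ((N : ℝ) + 1)) := by gcongr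
    _ = _ := by ring

/-- An exponential moment bound for the sum of `m` draws without replacement from a population of
`d + m` numbers in `[0, 1]`. -/
lemma sum_perm_exp_le {d : ℕ} (hd : 0 < d) (m : ℕ) (v : Fin (d + m) → ℝ)
    (hv : ∀ i, v i ∈ Set.Icc (0 : ℝ) 1) (s : ℝ) :
    ∑ π : Equiv.Perm (Fin (d + m)), Real.exp (s * ∑ i, if i.val < m then v (π i) else 0) ≤
      ((d + m).factorial : ℝ) * Real.exp (s * (m * (∑ i, v i) / ((d : ℝ) + m)) +
        s ^ 2 / 8 * ∑ j ∈ Finset.range m, ((d : ℝ) / (d + j)) ^ 2) := by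
  induction m with
  | zero => simp [Fintype.card_perm]
  | succ m ih =>
    have hdR : (0 : ℝ) < d := by exact_mod_cast hd
    have hdm : (0 : ℝ) < (d : ℝ) + m := by positivity
    set S := ∑ i, v i with hS
    set Φ := ∑ j ∈ Finset.range m, ((d : ℝ) / (d + j)) ^ 2 with hΦ
    change ∑ π : Equiv.Perm (Fin (d + m + 1)), Real.exp (s * ∑ i : Fin (d + m + 1),
      if i.val < m + 1 then v (π i) else 0) ≤ _
    have hsum : ∀ p : Fin (d + m + 1),
        ∑ i : Fin (d + m), v (Equiv.swap 0 p i.succ) = S - v p := by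
      intro p
      have : S = ∑ i : Fin (d + m + 1), v (Equiv.swap 0 p i) :=
        (Equiv.sum_comp (Equiv.swap 0 p) v).symm
      rw [this, Fin.sum_univ_succ]
      simp
    rw [← Equiv.sum_comp Equiv.Perm.decomposeFin.symm, Fintype.sum_prod_type]
    -- Condition on the first draw `p`. The other `m` draws come from a population of total `S - v
    -- p`, so their conditional mean contains `-m * v p / (d + m)`; the net coefficient of `v p` is
    -- `1 - m / (d + m) = d / (d + m)`. Hoeffding's lemma over `p` then contributes the new variance
    -- term.
    have step : ∀ p : Fin (d + m + 1), ∑ σ : Equiv.Perm (Fin (d + m)),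
        Real.exp (s * ∑ i : Fin (d + m + 1),
          if i.val < m + 1 then v (Equiv.Perm.decomposeFin.symm (p, σ) i) else 0) ≤
        ((d + m).factorial : ℝ) * Real.exp (s * (m * S / ((d : ℝ) + m)) + s ^ 2 / 8 * Φ) *
          Real.exp (s * (d / (d + m)) * v p) := by
      intro p
      have h := ih (fun i => v (Equiv.swap 0 p i.succ)) (fun i => hv _)
      rw [hsum] at h
      have heq : ∀ σ : Equiv.Perm (Fin (d + m)), Real.exp (s * ∑ i : Fin (d + m + 1),
          if i.val < m + 1 then v (Equiv.Perm.decomposeFin.symm (p, σ) i) else 0) =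
          Real.exp (s * v p) * Real.exp (s * ∑ i : Fin (d + m),
            if i.val < m then v (Equiv.swap 0 p (σ i).succ) else 0) := by
        intro σ
        rw [← Real.exp_add, Fin.sum_univ_succ]
        simp [mul_add]
      simp_rw [heq]
      rw [← Finset.mul_sum]
      refine (mul_le_mul_of_nonneg_left h (Real.exp_pos _).le).trans_eq ?_
      rw [mul_left_comm, mul_assoc, ← Real.exp_add, ← Real.exp_add]
      congr 2
      field_simp
      ring
    refine (Finset.sum_le_sum fun p _ => step p).trans ?_
    rw [← Finset.mul_sum]
    have hH : ∑ p : Fin (d + m + 1), Real.exp (s * (d / (d + m)) * v p) ≤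
        (((d + m : ℕ) : ℝ) + 1) * Real.exp (s * (d / (d + m)) * (S / (((d + m : ℕ) : ℝ) + 1)) +
          (s * (d / (d + m))) ^ 2 / 8) :=
      sum_exp_le_of_mem_Icc (N := d + m) v hv _
    refine (mul_le_mul_of_nonneg_left hH (by positivity)).trans_eq ?_
    rw [show d + (m + 1) = d + m + 1 from rfl, Nat.factorial_succ, Finset.sum_range_succ, ← hΦ]
    push_cast
    rw [show ∀ a b c e : ℝ, a * b * (c * e) = c * a * (b * e) by intros; ring, ← Real.exp_add]
    congr 2
    field_simp
    ring

/-- Telescoping from `1 / k ^ 2 ≤ 1 / (k - 1/2) - 1 / (k + 1/2)`. The half-integer shift keeps the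
final loss in the exponent down to a constant. -/
lemma sum_div_sq_le {d : ℕ} (hd : 0 < d) (m : ℕ) :
    ∑ j ∈ Finset.range m, ((d : ℝ) / (d + j)) ^ 2 ≤
      (d : ℝ) ^ 2 * (1 / ((d : ℝ) - 1 / 2) - 1 / ((d : ℝ) + m - 1 / 2)) := by
  have hdR : (1 : ℝ) ≤ d := by exact_mod_cast hd
  induction m with
  | zero => simp
  | succ m ih =>
    rw [Finset.sum_range_succ]
    have hm : (0 : ℝ) ≤ m := by positivity
    have h1 : (1 : ℝ) / (d + m) ^ 2 ≤
        1 / ((d : ℝ) + m - 1 / 2) - 1 / ((d : ℝ) + (m + 1 : ℕ) - 1 / 2) := by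
      push_cast
      rw [div_sub_div _ _ (by linarith) (by linarith),
        div_le_div_iff₀ (by positivity) (mul_pos (by linarith) (by linarith))]
      nlinarith
    have h2 := mul_le_mul_of_nonneg_left h1 (sq_nonneg (d : ℝ))
    rw [div_pow, div_eq_mul_one_div]
    linarith

/-- The exponential moment of the difference between the numbers of marked points in the two halves
of a randomly permuted population of `n + n` points. -/
lemma sum_perm_exp_sub_le {n : ℕ} (hn : 0 < n) (v : Fin (n + n) → ℝ)
    (hv : ∀ i, v i ∈ Set.Icc (0 : ℝ) 1) (t : ℝ) :
    ∑ π : Equiv.Perm (Fin (n + n)),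
        Real.exp (t * ∑ i, if i.val < n then -v (π i) else v (π i)) ≤
      ((n + n).factorial : ℝ) *
        Real.exp (t ^ 2 / 2 * ((n : ℝ) ^ 3 / (((n : ℝ) - 1 / 2) * (2 * n - 1 / 2)))) := by
  have hnR : (1 : ℝ) ≤ n := by exact_mod_cast hn
  -- Second half minus first half is the total minus twice the first half, so the previous bound
  -- applies with `s = -2 * t`, and its mean term cancels the total.
  have heq : ∀ π : Equiv.Perm (Fin (n + n)),
      Real.exp (t * ∑ i, if i.val < n then -v (π i) else v (π i)) =
        Real.exp (t * ∑ i, v i) *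
          Real.exp (-2 * t * ∑ i, if i.val < n then v (π i) else 0) := by
    intro π
    rw [← Real.exp_add, ← Equiv.sum_comp π v, Finset.mul_sum, Finset.mul_sum, Finset.mul_sum,
      ← Finset.sum_add_distrib]
    congr 1
    refine Finset.sum_congr rfl fun i _ => ?_
    split_ifs <;> ring
  simp_rw [heq]
  rw [← Finset.mul_sum]
  refine (mul_le_mul_of_nonneg_left (sum_perm_exp_le hn n v hv _) (Real.exp_pos _).le).trans ?_
  rw [mul_left_comm, ← Real.exp_add]
  gcongr
  have h1 := mul_le_mul_of_nonneg_left (sum_div_sq_le hn n) (by positivity : 0 ≤ t ^ 2 / 2)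
  have h2 : (n : ℝ) ^ 2 * (1 / ((n : ℝ) - 1 / 2) - 1 / ((n : ℝ) + n - 1 / 2)) =
      (n : ℝ) ^ 3 / (((n : ℝ) - 1 / 2) * (2 * n - 1 / 2)) := by
    rw [div_sub_div _ _ (by linarith) (by linarith), mul_div_assoc',
      show (n : ℝ) + n - 1 / 2 = 2 * n - 1 / 2 by ring]
    congr 1
    ring
  rw [h2] at h1
  refine le_trans (le_of_eq ?_) h1
  field_simp
  ring

/-! ### Sauer–Shelah: counting sign patterns. -/

/-- A bound for partial sums of binomial coefficients. -/
lemma sum_choose_le_exp {h N : ℕ} (hN : h ≤ N) :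
    ((∑ k ∈ Finset.Iic h, N.choose k : ℕ) : ℝ) ≤
      Real.exp ((h : ℝ) * (Real.log ((N : ℝ) / h) + 1)) := by
  rcases Nat.eq_zero_or_pos h with rfl | hpos
  · simp [show Finset.Iic 0 = ({0} : Finset ℕ) from rfl]
  have hR : (0 : ℝ) < h := by exact_mod_cast hpos
  have hNR : (0 : ℝ) < N := by exact_mod_cast hpos.trans_le hN
  have hle : (h : ℝ) ≤ N := by exact_mod_cast hN
  have hr : 1 ≤ (N : ℝ) / h := by rwa [le_div_iff₀ hR, one_mul]
  calc ((∑ k ∈ Finset.Iic h, N.choose k : ℕ) : ℝ)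
      = ∑ k ∈ Finset.Iic h, (N.choose k : ℝ) := by push_cast; rfl
    -- The inserted factor `(N / h) ^ (h - k)` is at least `1` for `k ≤ h`; it turns the sum into
    -- part of a binomial expansion.
    _ ≤ ∑ k ∈ Finset.Iic h, ((N : ℝ) / h) ^ h * (((h : ℝ) / N) ^ k * N.choose k) := by
        refine Finset.sum_le_sum fun k hk => ?_
        have hk' : k ≤ h := Finset.mem_Iic.1 hk
        rw [← mul_assoc]
        refine le_mul_of_one_le_left (by positivity) ?_
        rw [← Nat.sub_add_cancel hk', pow_add, mul_assoc, ← mul_pow, Nat.sub_add_cancel hk',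
          div_mul_div_cancel₀ hR.ne', div_self hNR.ne', one_pow, mul_one]
        exact one_le_pow₀ hr
    _ ≤ ∑ k ∈ Finset.range (N + 1), ((N : ℝ) / h) ^ h * (((h : ℝ) / N) ^ k * N.choose k) := by
        refine Finset.sum_le_sum_of_subset_of_nonneg (fun k hk => ?_) fun _ _ _ => by positivity
        have := Finset.mem_Iic.1 hk
        exact Finset.mem_range.2 (by omega)
    _ = ((N : ℝ) / h) ^ h * ((h : ℝ) / N + 1) ^ N := by
        rw [← Finset.mul_sum, add_pow]
        simp
    _ ≤ ((N : ℝ) / h) ^ h * Real.exp ((h : ℝ) / N) ^ N := by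
        gcongr
        exact Real.add_one_le_exp _
    _ = _ := by
        rw [mul_add, Real.exp_add, mul_one, ← Real.exp_nat_mul,
          mul_div_cancel₀ _ hNR.ne', Real.exp_nat_mul, Real.exp_log (by positivity)]

variable {𝒳 : Type*}

/-- The tuples of points on which some member of `F` predicts the label `1` exactly at the
indices in `T`. -/
def patternSet (F : Set (𝒳 → ℝ)) {N : ℕ} (T : Finset (Fin N)) : Set (Fin N → 𝒳) :=
  {z | ∃ f ∈ F, ∀ i, sgn (f (z i)) = if i ∈ T then 1 else -1}

open Classical in
/-- The sign patterns that `F` induces on a tuple of points. -/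
noncomputable def signPatterns (F : Set (𝒳 → ℝ)) {N : ℕ} (z : Fin N → 𝒳) :
    Finset (Finset (Fin N)) :=
  Finset.univ.filter fun T => z ∈ patternSet F T

lemma card_le_of_shatters {F : Set (𝒳 → ℝ)} {h : ℕ} (hvc : vcDim F = (h : ℕ∞)) {S : Finset 𝒳}
    (hS : Shatters F S) : S.card ≤ h := by
  have : (S.card : ℕ∞) ≤ vcDim F := le_iSup₂ (f := fun (S : Finset 𝒳) (_ : Shatters F S) =>
    (S.card : ℕ∞)) S hS
  rw [hvc] at this
  exact_mod_cast this

lemma vcDim_signPatterns_le {F : Set (𝒳 → ℝ)} {h : ℕ} (hvc : vcDim F = (h : ℕ∞)) {N : ℕ}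
    (z : Fin N → 𝒳) : (signPatterns F z).vcDim ≤ h := by
  classical
  refine Finset.sup_le fun S hS => ?_
  rw [Finset.mem_shatterer] at hS
  have hpat : ∀ T ⊆ S, ∃ f ∈ F, ∀ i ∈ S, sgn (f (z i)) = 1 ↔ i ∈ T := by
    intro T hT
    obtain ⟨U, hU, rfl⟩ := hS hT
    obtain ⟨f, hf, hfU⟩ := (Finset.mem_filter.1 hU).2
    refine ⟨f, hf, fun i hi => ?_⟩
    rw [hfU i]
    by_cases hiU : i ∈ U
    · simp [hi, hiU]
    · simp only [hiU, if_false, Finset.mem_inter, and_false, iff_false]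
      norm_num
  -- Repeated points receive equal labels, so a shattered index set has distinct points.
  have hinj : Set.InjOn z S := by
    intro i hi j hj hij
    obtain ⟨f, -, hf⟩ := hpat {i} (Finset.singleton_subset_iff.2 hi)
    have h1 := (hf i hi).2 (Finset.mem_singleton_self i)
    rw [hij] at h1
    exact (Finset.mem_singleton.1 ((hf j hj).1 h1)).symm
  rw [← Finset.card_image_of_injOn hinj]
  refine card_le_of_shatters hvc fun T hT => ?_
  obtain ⟨f, hf, hfT⟩ := hpat (S.filter fun i => z i ∈ T) (Finset.filter_subset _ _)
  refine ⟨f, hf, fun x hx => ?_⟩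
  obtain ⟨i, hi, rfl⟩ := Finset.mem_image.1 hx
  rw [hfT i hi, Finset.mem_filter, and_iff_right hi]

lemma card_signPatterns_le {F : Set (𝒳 → ℝ)} {h : ℕ} (hvc : vcDim F = (h : ℕ∞)) {N : ℕ}
    (hN : h ≤ N) (z : Fin N → 𝒳) :
    ((signPatterns F z).card : ℝ) ≤ Real.exp ((h : ℝ) * (Real.log ((N : ℝ) / h) + 1)) := by
  refine le_trans ?_ (sum_choose_le_exp hN)
  have h1 := (signPatterns F z).card_le_card_shatterer.trans
    Finset.card_shatterer_le_sum_vcDim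
  rw [Fintype.card_fin] at h1
  exact_mod_cast h1.trans (Finset.sum_le_sum_of_subset
    (Finset.Iic_subset_Iic.2 (vcDim_signPatterns_le hvc z)))

/-! ### Exponential weights of patterns and their average over permutations. -/

/-- The error at the index `i` of the sign pattern `T` on the points `z` labelled by `y`. -/
noncomputable def patternError (y : 𝒳 → ℝ) {N : ℕ} (z : Fin N → 𝒳) (T : Finset (Fin N))
    (i : Fin N) : ℝ :=
  if (if i ∈ T then (1 : ℝ) else -1) ≠ y (z i) then 1 else 0

lemma patternError_mem_Icc (y : 𝒳 → ℝ) {N : ℕ} (z : Fin N → 𝒳) (T : Finset (Fin N))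
    (i : Fin N) : patternError y z T i ∈ Set.Icc (0 : ℝ) 1 := by
  unfold patternError
  split_ifs <;> simp

lemma patternError_eq_zeroOneLoss (y : 𝒳 → ℝ) {N : ℕ} {z : Fin N → 𝒳} {T : Finset (Fin N)}
    {f : 𝒳 → ℝ} {i : Fin N} (hf : sgn (f (z i)) = if i ∈ T then 1 else -1) :
    patternError y z T i = zeroOneLoss (f (z i)) (y (z i)) := by
  rw [patternError, zeroOneLoss, hf]

/-- The exponential of `t` times the difference between the numbers of errors of the pattern `T` on
the second and on the first half of `z`. -/
noncomputable def patternWeight (y : 𝒳 → ℝ) (t : ℝ) {n : ℕ} (T : Finset (Fin (n + n)))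
    (z : Fin (n + n) → 𝒳) : ℝ :=
  Real.exp (t * ∑ i, if i.val < n then -patternError y z T i else patternError y z T i)

/-- The sum of the weights of the patterns `T` with `z ∈ C T`. -/
noncomputable def totalWeight (y : 𝒳 → ℝ) (t : ℝ) {n : ℕ}
    (C : Finset (Fin (n + n)) → Set (Fin (n + n) → 𝒳)) (z : Fin (n + n) → 𝒳) : ENNReal :=
  ∑ T, (C T).indicator (fun z => ENNReal.ofReal (patternWeight y t T z)) z

/-- Permuting the points merely relabels the patterns. After reindexing, the patterns summed over no
longer depend on `π`, so the sums over `T` and `π` can be exchanged. -/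
lemma totalWeight_patternSet_comp_perm (F : Set (𝒳 → ℝ)) (y : 𝒳 → ℝ) (t : ℝ) {n : ℕ}
    (z : Fin (n + n) → 𝒳) (π : Equiv.Perm (Fin (n + n))) :
    totalWeight y t (fun T => patternSet F T) (z ∘ π) =
      ∑ T ∈ signPatterns F z, ENNReal.ofReal (Real.exp (t * ∑ i : Fin (n + n),
        if i.val < n then -patternError y z T (π i) else patternError y z T (π i))) := by
  classical
  rw [totalWeight, signPatterns, Finset.sum_filter, ← Equiv.sum_comp π.symm.finsetCongr]
  refine Finset.sum_congr rfl fun T _ => ?_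
  have hmem : ∀ i, i ∈ π.symm.finsetCongr T ↔ π i ∈ T := by
    intro i
    rw [Equiv.finsetCongr_apply, Finset.mem_map_equiv, Equiv.symm_symm]
  have herr : ∀ i, patternError y (z ∘ π) (π.symm.finsetCongr T) i = patternError y z T (π i) := by
    intro i
    simp only [patternError, hmem, Function.comp_apply]
  have hset : z ∘ π ∈ patternSet F (π.symm.finsetCongr T) ↔ z ∈ patternSet F T := by
    simp only [patternSet, Set.mem_ofPred_eq, hmem, Function.comp_apply]
    refine exists_congr fun f => and_congr_right fun _ => ?_
    exact ⟨fun hf i => by simpa using hf (π.symm i), fun hf i => hf (π i)⟩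
  rw [Set.indicator_apply]
  simp only [hset, patternWeight, herr]

lemma sum_perm_totalWeight_le {F : Set (𝒳 → ℝ)} {h : ℕ} (hvc : vcDim F = (h : ℕ∞)) {n : ℕ}
    (hn : 0 < n) (hhn : h ≤ n + n) (y : 𝒳 → ℝ) (t : ℝ) (z : Fin (n + n) → 𝒳) :
    ∑ π : Equiv.Perm (Fin (n + n)), totalWeight y t (fun T => patternSet F T) (z ∘ π) ≤
      ((n + n).factorial : ENNReal) * ENNReal.ofReal
        (Real.exp ((h : ℝ) * (Real.log (((n + n : ℕ) : ℝ) / h) + 1)) *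
        Real.exp (t ^ 2 / 2 * ((n : ℝ) ^ 3 / (((n : ℝ) - 1 / 2) * (2 * n - 1 / 2))))) := by
  simp_rw [totalWeight_patternSet_comp_perm]
  rw [Finset.sum_comm]
  have h1 : ∀ T ∈ signPatterns F z, ∑ π : Equiv.Perm (Fin (n + n)),
      ENNReal.ofReal (Real.exp (t * ∑ i : Fin (n + n),
        if i.val < n then -patternError y z T (π i) else patternError y z T (π i))) ≤
      ENNReal.ofReal (((n + n).factorial : ℝ) *
        Real.exp (t ^ 2 / 2 * ((n : ℝ) ^ 3 / (((n : ℝ) - 1 / 2) * (2 * n - 1 / 2))))) := by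
    intro T _
    rw [← ENNReal.ofReal_sum_of_nonneg fun _ _ => (Real.exp_pos _).le]
    exact ENNReal.ofReal_le_ofReal
      (sum_perm_exp_sub_le hn (patternError y z T) (patternError_mem_Icc y z T) t)
  refine (Finset.sum_le_sum h1).trans ?_
  rw [Finset.sum_const, nsmul_eq_mul, ← ENNReal.ofReal_natCast, ← ENNReal.ofReal_natCast,
    ← ENNReal.ofReal_mul (by positivity), ← ENNReal.ofReal_mul (by positivity)]
  refine ENNReal.ofReal_le_ofReal ?_
  rw [mul_left_comm]
  gcongr
  exact card_signPatterns_le hvc hhn z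

/-- A single function is dominated by the term of its own pattern. Only `patternSet F T ⊆ C T` is
needed, so measurable hulls may be used for `C` with no exceptional null set. -/
lemma ofReal_exp_le_totalWeight {F : Set (𝒳 → ℝ)} {f : 𝒳 → ℝ} (hf : f ∈ F) (y : 𝒳 → ℝ) (t : ℝ)
    {n : ℕ} {C : Finset (Fin (n + n)) → Set (Fin (n + n) → 𝒳)} (hC : ∀ T, patternSet F T ⊆ C T)
    (x x' : Fin n → 𝒳) :
    ENNReal.ofReal (Real.exp (t * (∑ i, zeroOneLoss (f (x' i)) (y (x' i)) -
      ∑ i, zeroOneLoss (f (x i)) (y (x i))))) ≤ totalWeight y t C (Fin.append x x') := by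
  classical
  set z := Fin.append x x' with hz
  set T : Finset (Fin (n + n)) := Finset.univ.filter fun i => sgn (f (z i)) = 1 with hT
  have hsgn : ∀ i, sgn (f (z i)) = if i ∈ T then 1 else -1 := by
    intro i
    simp only [hT, Finset.mem_filter, Finset.mem_univ, true_and]
    unfold sgn
    split_ifs <;> simp_all
  have hmem : z ∈ C T := hC T ⟨f, hf, hsgn⟩
  have hw : patternWeight y t T z = Real.exp (t * (∑ i, zeroOneLoss (f (x' i)) (y (x' i)) -
      ∑ i, zeroOneLoss (f (x i)) (y (x i)))) := by
    rw [patternWeight]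
    congr 2
    simp_rw [fun i => patternError_eq_zeroOneLoss y (hsgn i)]
    rw [Fin.sum_univ_add]
    simp only [hz, Fin.append_left, Fin.append_right, Fin.val_castAdd, Fin.val_natAdd, Fin.is_lt,
      if_true, (Nat.le_add_right n _).not_gt, if_false, Finset.sum_neg_distrib, sub_eq_neg_add]
  rw [← hw]
  refine le_trans (le_of_eq ?_) (Finset.single_le_sum (fun _ _ => zero_le)
    (Finset.mem_univ T))
  rw [Set.indicator_of_mem hmem]

/-! ### Measurability and invariance of the product measure. -/

section Measure

variable [MeasurableSpace 𝒳]

lemma measurable_patternWeight {y : 𝒳 → ℝ} (hy : Measurable y) (t : ℝ) {n : ℕ}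
    (T : Finset (Fin (n + n))) : Measurable (patternWeight y t T) := by
  have herr : ∀ i, Measurable fun z : Fin (n + n) → 𝒳 => patternError y z T i := by
    intro i
    refine Measurable.ite ?_ measurable_const measurable_const
    exact (measurableSet_eq_fun measurable_const (hy.comp (measurable_pi_apply i))).compl
  refine Real.measurable_exp.comp (measurable_const.mul
    (Finset.measurable_sum _ fun i _ => ?_))
  split_ifs
  · exact (herr i).neg
  · exact herr i

lemma measurable_totalWeight {y : 𝒳 → ℝ} (hy : Measurable y) (t : ℝ) {n : ℕ}
    {C : Finset (Fin (n + n)) → Set (Fin (n + n) → 𝒳)} (hC : ∀ T, MeasurableSet (C T)) :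
    Measurable (totalWeight y t C) :=
  Finset.measurable_sum _ fun T _ =>
    ((measurable_patternWeight hy t T).ennreal_ofReal).indicator (hC T)

lemma measurePreserving_comp_perm (P : Measure 𝒳) [IsProbabilityMeasure P] {N : ℕ}
    (π : Equiv.Perm (Fin N)) :
    MeasurePreserving (fun z : Fin N → 𝒳 => z ∘ π) (Measure.pi fun _ => P)
      (Measure.pi fun _ => P) := by
  have hm : Measurable fun z : Fin N → 𝒳 => z ∘ π :=
    measurable_pi_lambda _ fun i => measurable_pi_apply (π i)
  refine ⟨hm, (Measure.pi_eq fun s hs => ?_).symm⟩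
  rw [Measure.map_apply hm (MeasurableSet.univ_pi hs)]
  have : (fun z : Fin N → 𝒳 => z ∘ π) ⁻¹' Set.univ.pi s = Set.univ.pi fun i => s (π.symm i) := by
    ext z
    simp only [Set.mem_preimage, Set.mem_univ_pi, Function.comp_apply]
    exact ⟨fun hz i => by simpa using hz (π.symm i), fun hz i => by simpa using hz (π i)⟩
  rw [this, Measure.pi_pi]
  exact Equiv.prod_comp π.symm fun i => P (s i)

lemma measurable_append (m n : ℕ) :
    Measurable fun p : (Fin m → 𝒳) × (Fin n → 𝒳) => Fin.append p.1 p.2 := by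
  refine measurable_pi_lambda _ fun i => ?_
  induction i using Fin.addCases with
  | left i =>
    simp only [Fin.append_left]
    exact (measurable_pi_apply i).comp measurable_fst
  | right i =>
    simp only [Fin.append_right]
    exact (measurable_pi_apply i).comp measurable_snd

lemma measurePreserving_append (P : Measure 𝒳) [IsProbabilityMeasure P] (m n : ℕ) :
    MeasurePreserving (fun p : (Fin m → 𝒳) × (Fin n → 𝒳) => Fin.append p.1 p.2)
      ((Measure.pi fun _ => P).prod (Measure.pi fun _ => P)) (Measure.pi fun _ => P) := by
  refine ⟨measurable_append m n, (Measure.pi_eq fun s hs => ?_).symm⟩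
  rw [Measure.map_apply (measurable_append m n) (MeasurableSet.univ_pi hs)]
  have : (fun p : (Fin m → 𝒳) × (Fin n → 𝒳) => Fin.append p.1 p.2) ⁻¹' Set.univ.pi s =
      (Set.univ.pi fun i => s (Fin.castAdd n i)) ×ˢ
        (Set.univ.pi fun i => s (Fin.natAdd m i)) := by
    ext p
    simp only [Set.mem_preimage, Set.mem_univ_pi, Set.mem_prod]
    rw [Fin.forall_fin_add]
    simp
  rw [this, Measure.prod_prod, Measure.pi_pi, Measure.pi_pi, Fin.prod_univ_add]

lemma lintegral_totalWeight_le {P : Measure 𝒳} [IsProbabilityMeasure P] {y : 𝒳 → ℝ}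
    (hy : Measurable y) {F : Set (𝒳 → ℝ)} (hF : IsMeasurableClass P F) {h : ℕ}
    (hvc : vcDim F = (h : ℕ∞)) {n : ℕ} (hn : 0 < n) (hhn : h ≤ n + n) (t : ℝ) :
    ∫⁻ z, totalWeight y t (fun T : Finset (Fin (n + n)) =>
        toMeasurable (Measure.pi fun _ => P) (patternSet F T)) z ∂(Measure.pi fun _ => P) ≤
      ENNReal.ofReal (Real.exp ((h : ℝ) * (Real.log (((n + n : ℕ) : ℝ) / h) + 1)) *
        Real.exp (t ^ 2 / 2 * ((n : ℝ) ^ 3 / (((n : ℝ) - 1 / 2) * (2 * n - 1 / 2))))) := by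
  set Q : Measure (Fin (n + n) → 𝒳) := Measure.pi fun _ => P with hQ
  set G := totalWeight y t fun T : Finset (Fin (n + n)) => toMeasurable Q (patternSet F T) with hG
  have hGm : Measurable G := measurable_totalWeight hy t fun T => measurableSet_toMeasurable _ _
  -- Null measurability of the pattern sets makes their measurable hulls agree with them almost
  -- everywhere, so the pointwise permutation bound applies to `G` under the integral.
  have hae : ∀ᵐ z ∂Q, G z = totalWeight y t (fun T => patternSet F T) z := by
    have h1 : ∀ T : Finset (Fin (n + n)), toMeasurable Q (patternSet F T) =ᵐ[Q] patternSet F T :=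
      fun T => (hF.nullMeasurableSet (n + n) fun i => if i ∈ T then 1 else -1).toMeasurable_ae_eq
    have h2 : ∀ᵐ z ∂Q, ∀ T : Finset (Fin (n + n)),
        (z ∈ toMeasurable Q (patternSet F T)) = (z ∈ patternSet F T) :=
      ae_all_iff.2 fun T => h1 T
    filter_upwards [h2] with z hz
    classical
    simp only [hG, totalWeight, Set.indicator_apply]
    exact Finset.sum_congr rfl fun T _ => if_congr (iff_of_eq (hz T)) rfl rfl
  have hfac : ((n + n).factorial : ENNReal) ≠ 0 := by
    exact_mod_cast (Nat.factorial_pos _).ne'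
  have hkey : ((n + n).factorial : ENNReal) * ∫⁻ z, G z ∂Q ≤ ((n + n).factorial : ENNReal) *
      ENNReal.ofReal (Real.exp ((h : ℝ) * (Real.log (((n + n : ℕ) : ℝ) / h) + 1)) *
        Real.exp (t ^ 2 / 2 * ((n : ℝ) ^ 3 / (((n : ℝ) - 1 / 2) * (2 * n - 1 / 2))))) := by
    calc ((n + n).factorial : ENNReal) * ∫⁻ z, G z ∂Q
        = ∑ π : Equiv.Perm (Fin (n + n)), ∫⁻ z, G (z ∘ π) ∂Q := by
          rw [Finset.sum_congr rfl fun π _ =>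
            (measurePreserving_comp_perm P π).lintegral_comp hGm]
          simp [Fintype.card_perm, hQ]
      _ = ∫⁻ z, ∑ π : Equiv.Perm (Fin (n + n)), G (z ∘ π) ∂Q := by
          rw [lintegral_finsetSum]
          exact fun π _ => hGm.comp (measurePreserving_comp_perm P π).measurable
      _ = ∫⁻ z, ∑ π : Equiv.Perm (Fin (n + n)),
            totalWeight y t (fun T => patternSet F T) (z ∘ π) ∂Q := by
          refine lintegral_congr_ae ?_
          have : ∀ᵐ z ∂Q, ∀ π : Equiv.Perm (Fin (n + n)),
              G (z ∘ π) = totalWeight y t (fun T => patternSet F T) (z ∘ π) :=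
            ae_all_iff.2 fun π => (measurePreserving_comp_perm P π).quasiMeasurePreserving.ae hae
          filter_upwards [this] with z hz
          exact Finset.sum_congr rfl fun π _ => hz π
      _ ≤ ∫⁻ _, _ ∂Q := lintegral_mono fun z => sum_perm_totalWeight_le hvc hn hhn y t z
      _ = _ := by simp [hQ]
  exact (ENNReal.mul_le_mul_iff_right hfac (ENNReal.natCast_ne_top _)).1 hkey

end Measure

/-! ### Risk, ghost sample and the uniform deviation bound. -/

section Risk

variable [MeasurableSpace 𝒳]

lemma zeroOneLoss_mem_Icc (a b : ℝ) : zeroOneLoss a b ∈ Set.Icc (0 : ℝ) 1 := by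
  unfold zeroOneLoss
  split_ifs <;> simp

lemma zeroOneLoss_le_add (a l : ℝ) {b : ℝ} (hb : b = -1 ∨ b = 1) :
    zeroOneLoss a b ≤ zeroOneLoss a (sgn l) + (l - b) ^ 2 := by
  by_cases h : sgn a = sgn l
  · have h0 : zeroOneLoss a b ≤ (l - b) ^ 2 := by
      unfold zeroOneLoss
      rw [h]
      unfold sgn
      rcases hb with rfl | rfl <;> split_ifs <;> first | positivity | nlinarith | simp_all
    linarith [(zeroOneLoss_mem_Icc a (sgn l)).1]
  · have h1 : zeroOneLoss a (sgn l) = 1 := by simp [zeroOneLoss, h]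
    linarith [(zeroOneLoss_mem_Icc a b).2, sq_nonneg (l - b)]

lemma measurable_sgn : Measurable sgn :=
  Measurable.ite measurableSet_Ici measurable_const measurable_const

lemma measurable_zeroOneLoss {f y : 𝒳 → ℝ} (hf : Measurable f) (hy : Measurable y) :
    Measurable fun x => zeroOneLoss (f x) (y x) :=
  Measurable.ite (measurableSet_eq_fun (measurable_sgn.comp hf) hy).compl
    measurable_const measurable_const

lemma integrable_zeroOneLoss (P : Measure 𝒳) [IsProbabilityMeasure P] {f y : 𝒳 → ℝ}
    (hf : Measurable f) (hy : Measurable y) :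
    Integrable (fun x => zeroOneLoss (f x) (y x)) P :=
  Integrable.of_mem_Icc 0 1 (measurable_zeroOneLoss hf hy).aemeasurable
    (ae_of_all _ fun _ => zeroOneLoss_mem_Icc _ _)

lemma risk_le_one (P : Measure 𝒳) [IsProbabilityMeasure P] {f y : 𝒳 → ℝ}
    (hf : Measurable f) (hy : Measurable y) : risk P y f ≤ 1 := by
  have := integral_mono (integrable_zeroOneLoss P hf hy) (integrable_const (1 : ℝ))
    fun x => (zeroOneLoss_mem_Icc (f x) (y x)).2
  simpa [risk] using this

lemma exp_le_lintegral_exp_sum (P : Measure 𝒳) [IsProbabilityMeasure P] {f y : 𝒳 → ℝ}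
    (hf : Measurable f) (hy : Measurable y) (t c : ℝ) (n : ℕ) :
    ENNReal.ofReal (Real.exp (t * (n * risk P y f - c))) ≤
      ∫⁻ x' : Fin n → 𝒳, ENNReal.ofReal
        (Real.exp (t * (∑ i, zeroOneLoss (f (x' i)) (y (x' i)) - c))) ∂(Measure.pi fun _ => P) := by
  set Q : Measure (Fin n → 𝒳) := Measure.pi fun _ => P with hQ
  set g : (Fin n → 𝒳) → ℝ := fun x' => t * (∑ i, zeroOneLoss (f (x' i)) (y (x' i)) - c) with hg
  have hev : ∀ i : Fin n, MeasurePreserving (fun x' : Fin n → 𝒳 => x' i) Q P :=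
    fun i => measurePreserving_eval (fun _ => P) i
  have hloss : ∀ i : Fin n, Integrable (fun x' : Fin n → 𝒳 =>
      zeroOneLoss (f (x' i)) (y (x' i))) Q :=
    fun i => (hev i).integrable_comp_of_integrable (integrable_zeroOneLoss P hf hy)
  have hsum : Integrable (fun x' : Fin n → 𝒳 => ∑ i, zeroOneLoss (f (x' i)) (y (x' i))) Q :=
    integrable_finsetSum _ fun i _ => hloss i
  have hgi : Integrable g Q := (hsum.sub (integrable_const c)).const_mul t
  have hgm : Measurable g := measurable_const.mul ((Finset.measurable_sum _ fun i _ =>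
    (measurable_zeroOneLoss hf hy).comp (measurable_pi_apply i)).sub measurable_const)
  have hint : ∫ x', g x' ∂Q = t * (n * risk P y f - c) := by
    rw [hg, integral_const_mul, integral_sub hsum (integrable_const c),
      integral_finsetSum _ fun i _ => hloss i]
    have : ∀ i : Fin n, ∫ x' : Fin n → 𝒳, zeroOneLoss (f (x' i)) (y (x' i)) ∂Q = risk P y f := by
      intro i
      rw [risk, ← (hev i).map_eq, integral_map (hev i).measurable.aemeasurable
        (measurable_zeroOneLoss hf hy).aestronglyMeasurable]
    simp [this]
  have hbound : ∀ x', ‖Real.exp (g x')‖ ≤ Real.exp (|t| * (n + |c|)) := by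
    intro x'
    rw [Real.norm_of_nonneg (Real.exp_pos _).le]
    refine Real.exp_le_exp.2 ((le_abs_self _).trans ?_)
    rw [abs_mul]
    refine mul_le_mul_of_nonneg_left ((abs_sub _ _).trans ?_) (abs_nonneg t)
    gcongr
    rw [abs_of_nonneg (Finset.sum_nonneg fun i _ => (zeroOneLoss_mem_Icc _ _).1)]
    refine (Finset.sum_le_sum fun i _ => (zeroOneLoss_mem_Icc _ _).2).trans ?_
    simp
  have hexpi : Integrable (fun x' => Real.exp (g x')) Q :=
    Integrable.of_bound (Real.measurable_exp.comp hgm).aestronglyMeasurable _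
      (ae_of_all _ hbound)
  rw [← ofReal_integral_eq_lintegral_ofReal hexpi (ae_of_all _ fun _ => (Real.exp_pos _).le),
    ← hint]
  exact ENNReal.ofReal_le_ofReal (convexOn_exp.map_integral_le Real.continuous_exp.continuousOn
    isClosed_univ (ae_of_all _ fun _ => Set.mem_univ _) hgi hexpi)

/-- For a suitable `t`, the moment bound on the total pattern weight beats the Markov threshold by
the factor `η`. -/
lemma exp_mul_exp_le {h n : ℕ} (hn : 0 < n) (hhn : h ≤ n + n) {η : ℝ} (hη_pos : 0 < η)
    (hη_le : η ≤ 1) (hε : inductiveError h n η ≤ 1) :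
    ∃ t : ℝ, 0 ≤ t ∧ Real.exp ((h : ℝ) * (Real.log (((n + n : ℕ) : ℝ) / h) + 1)) *
        Real.exp (t ^ 2 / 2 * ((n : ℝ) ^ 3 / (((n : ℝ) - 1 / 2) * (2 * n - 1 / 2)))) ≤
      Real.exp (t * (n * inductiveError h n η)) * η := by
  have hnR : (1 : ℝ) ≤ n := by exact_mod_cast hn
  set V := (n : ℝ) ^ 3 / (((n : ℝ) - 1 / 2) * (2 * n - 1 / 2)) with hV
  have hV_pos : 0 < V := div_pos (by positivity) (mul_pos (by linarith) (by linarith))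
  set H := (h : ℝ) * (Real.log (((n + n : ℕ) : ℝ) / h) + 1) with hH
  have hH_nonneg : 0 ≤ H := by
    rcases Nat.eq_zero_or_pos h with rfl | hpos
    · simp [hH]
    · refine mul_nonneg (by positivity) (add_nonneg (Real.log_nonneg ?_) zero_le_one)
      rw [le_div_iff₀ (by exact_mod_cast hpos), one_mul]
      exact_mod_cast hhn
  set ε := inductiveError h n η with hε_def
  have hε_nonneg : 0 ≤ ε := Real.sqrt_nonneg _
  have hlog : Real.log (η / 4) = Real.log η - 2 * Real.log 2 := by
    rw [Real.log_div hη_pos.ne' (by norm_num), show (4 : ℝ) = 2 ^ 2 by norm_num, Real.log_pow]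
    norm_num
  have hlogη : Real.log η ≤ 0 := Real.log_nonpos hη_pos.le hη_le
  have hlog2 := Real.log_two_gt_d9
  have hsq : n * ε ^ 2 = H - Real.log (η / 4) := by
    have : ε = Real.sqrt ((H - Real.log (η / 4)) / n) := by
      rw [hε_def, inductiveError, hH]
      push_cast
      rw [two_mul]
    rw [this, Real.sq_sqrt (div_nonneg (by linarith) (by positivity))]
    field_simp
  -- This `t` maximizes `t * n * ε - t ^ 2 * V / 2`, with maximum `n ^ 2 / (2 * V) * ε ^ 2`.
  refine ⟨n * ε / V, by positivity, ?_⟩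
  conv_rhs => rw [← Real.exp_log hη_pos]
  rw [← Real.exp_add, ← Real.exp_add, Real.exp_le_exp]
  -- The exponent falls short of `n * ε ^ 2` by at most `3/4 * ε ^ 2 ≤ 3/4`, which is less than the
  -- `log 4` supplied by `η / 4`.
  have hVn : (n : ℝ) - 3 / 4 ≤ n ^ 2 / (2 * V) := by
    have : (n : ℝ) ^ 2 / (2 * V) = ((n : ℝ) - 1 / 2) * (2 * n - 1 / 2) / (2 * n) := by
      rw [hV]
      have h1 : (n : ℝ) - 1 / 2 ≠ 0 := by linarith
      have h2 : 2 * (n : ℝ) - 1 / 2 ≠ 0 := by linarith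
      rw [mul_div_assoc', div_div_eq_mul_div, div_eq_div_iff (by positivity) (by positivity)]
      ring
    rw [this, le_div_iff₀ (by positivity)]
    nlinarith
  have h1 : (n * ε / V) ^ 2 / 2 * V = n ^ 2 / (2 * V) * ε ^ 2 := by field_simp
  have h2 : n * ε / V * (n * ε) = 2 * (n ^ 2 / (2 * V) * ε ^ 2) := by field_simp
  have h3 := mul_le_mul_of_nonneg_right hVn (sq_nonneg ε)
  have h4 : ε ^ 2 ≤ 1 := by nlinarith
  rw [h1, h2]
  nlinarith

/-- The one-sided uniform deviation bound for a class of finite VC dimension. -/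
lemma exists_measurableSet_risk_le {P : Measure 𝒳} [IsProbabilityMeasure P] {y : 𝒳 → ℝ}
    (hy : Measurable y) {F : Set (𝒳 → ℝ)} (hF : IsMeasurableClass P F) {h : ℕ}
    (hvc : vcDim F = (h : ℕ∞)) {n : ℕ} (hn : 0 < n) (hhn : h ≤ n + n) {η : ℝ} (hη_pos : 0 < η)
    (hη_le : η ≤ 1) :
    ∃ B : Set (Fin n → 𝒳), MeasurableSet B ∧
      Measure.pi (fun _ => P) B ≤ ENNReal.ofReal η ∧ ∀ x ∉ B, ∀ f ∈ F,
        risk P y f ≤ (1 / (n : ℝ)) * ∑ i, zeroOneLoss (f (x i)) (y (x i)) +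
          inductiveError h n η := by
  have hnR : (0 : ℝ) < n := by exact_mod_cast hn
  -- If the error term is at least `1` the bound is trivial; otherwise `ε ≤ 1` is available for
  -- choosing `t`.
  rcases le_or_gt 1 (inductiveError h n η) with hε | hε
  · refine ⟨∅, MeasurableSet.empty, by simp, fun x _ f hf => ?_⟩
    have h1 := risk_le_one P (hF.measurable f hf) hy
    have h2 : 0 ≤ (1 / (n : ℝ)) * ∑ i, zeroOneLoss (f (x i)) (y (x i)) :=
      mul_nonneg (by positivity) (Finset.sum_nonneg fun i _ => (zeroOneLoss_mem_Icc _ _).1)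
    linarith
  obtain ⟨t, ht, hexp⟩ := exp_mul_exp_le hn hhn hη_pos hη_le hε.le
  set ε := inductiveError h n η
  set C : Finset (Fin (n + n)) → Set (Fin (n + n) → 𝒳) := fun T =>
    toMeasurable (Measure.pi fun _ => P) (patternSet F T) with hC
  have hGm : Measurable (totalWeight y t C) :=
    measurable_totalWeight hy t fun T => measurableSet_toMeasurable _ _
  have hG2 : Measurable fun p : (Fin n → 𝒳) × (Fin n → 𝒳) =>
      totalWeight y t C (Fin.append p.1 p.2) := hGm.comp (measurable_append n n)
  -- The ghost sample is integrated out, leaving a function of the observed sample alone. It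
  -- dominates every `f` at once, so Markov's inequality for `Φ` needs no union bound.
  set Φ : (Fin n → 𝒳) → ENNReal := fun x =>
    ∫⁻ x', totalWeight y t C (Fin.append x x') ∂(Measure.pi fun _ => P) with hΦ
  have hΦm : Measurable Φ := hG2.lintegral_prod_right'
  refine ⟨{x | ENNReal.ofReal (Real.exp (t * (n * ε))) ≤ Φ x},
    measurableSet_le measurable_const hΦm, ?_, fun x hx f hf => ?_⟩
  · have hint : ∫⁻ x, Φ x ∂(Measure.pi fun _ => P) ≤
        ENNReal.ofReal (Real.exp (t * (n * ε))) * ENNReal.ofReal η := by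
      rw [← ENNReal.ofReal_mul (Real.exp_pos _).le]
      refine le_trans (le_of_eq ?_) ((lintegral_totalWeight_le hy hF hvc hn hhn t).trans
        (ENNReal.ofReal_le_ofReal hexp))
      rw [← (measurePreserving_append P n n).lintegral_comp hGm, lintegral_prod _ hG2.aemeasurable]
    have hmarkov := (mul_meas_ge_le_lintegral (μ := Measure.pi fun _ => P) hΦm
      (ENNReal.ofReal (Real.exp (t * (n * ε))))).trans hint
    exact (ENNReal.mul_le_mul_iff_right (ENNReal.ofReal_pos.2 (Real.exp_pos _)).ne'
      ENNReal.ofReal_ne_top).1 hmarkov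
  · by_contra! hlt
    refine hx ?_
    calc ENNReal.ofReal (Real.exp (t * (n * ε)))
        ≤ ENNReal.ofReal (Real.exp (t * (n * risk P y f -
            ∑ i, zeroOneLoss (f (x i)) (y (x i))))) := by
          refine ENNReal.ofReal_le_ofReal (Real.exp_le_exp.2 (mul_le_mul_of_nonneg_left ?_ ht))
          have h1 := mul_le_mul_of_nonneg_left hlt.le hnR.le
          rw [mul_add, ← mul_assoc, mul_one_div_cancel hnR.ne', one_mul] at h1
          linarith
      _ ≤ _ := exp_le_lintegral_exp_sum P (hF.measurable f hf) hy t _ n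
      _ ≤ Φ x := lintegral_mono fun x' =>
          ofReal_exp_le_totalWeight hf y t (fun T => subset_toMeasurable _ _) x x'

end Risk

end MaxMarginCuts

theorem mainTheorem4 {Ω 𝒳 : Type*} [MeasurableSpace Ω] [MeasurableSpace 𝒳]
    (μ : Measure Ω) [IsProbabilityMeasure μ] (P : Measure 𝒳) [IsProbabilityMeasure P]
    (y : 𝒳 → ℝ) (hy : Measurable y) (hy_label : ∀ x, y x = -1 ∨ y x = 1)
    (F : Set (𝒳 → ℝ)) (hF : MaxMarginCuts.IsMeasurableClass P F)
    (h : ℕ) (hvc : MaxMarginCuts.vcDim F = (h : ℕ∞))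
    (n : ℕ) (hn : 1 ≤ n) (hhn : h ≤ 2 * n)
    (η : ℝ) (hη_pos : 0 < η) (hη_le : η ≤ 1)
    (x : Fin n → Ω → 𝒳) (hx : ∀ i, Measurable (x i)) (hx_indep : iIndepFun x μ)
    (hx_law : ∀ i, μ.map (x i) = P) :
    ∃ A : Set Ω, MeasurableSet A ∧ 1 - η ≤ μ.real A ∧
      ∀ ω ∈ A, ∀ f ∈ F, ∀ l : Fin n → ℝ,
        MaxMarginCuts.risk P y f ≤
          (1 / (n : ℝ)) * ∑ i, MaxMarginCuts.zeroOneLoss (f (x i ω)) (MaxMarginCuts.sgn (l i)) +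
          (1 / (n : ℝ)) * ∑ i, (l i - y (x i ω)) ^ 2 +
          MaxMarginCuts.inductiveError h n η := by
  obtain ⟨B, hB, hPB, hrisk⟩ := MaxMarginCuts.exists_measurableSet_risk_le hy hF hvc hn
    (by omega : h ≤ n + n) hη_pos hη_le
  have hX : Measurable fun ω i => x i ω := measurable_pi_lambda _ hx
  have hlaw : μ.map (fun ω i => x i ω) = Measure.pi fun _ => P := by
    rw [(iIndepFun_iff_map_fun_eq_pi_map fun i => (hx i).aemeasurable).1 hx_indep]
    simp_rw [hx_law]
  have hm : MeasurableSet ((fun ω i => x i ω) ⁻¹' B) := hX hB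
  refine ⟨((fun ω i => x i ω) ⁻¹' B)ᶜ, hm.compl, ?_, fun ω hω f hf l => ?_⟩
  · rw [probReal_compl_eq_one_sub hm]
    have : μ.real ((fun ω i => x i ω) ⁻¹' B) ≤ η := by
      refine ENNReal.toReal_le_of_le_ofReal hη_pos.le ?_
      rwa [← Measure.map_apply hX hB, hlaw]
    linarith
  · refine (hrisk _ hω f hf).trans ?_
    rw [← mul_add, ← Finset.sum_add_distrib]
    gcongr with i
    exact MaxMarginCuts.zeroOneLoss_le_add _ _ (hy_label _)
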